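/- For $T>0$ consider the zeros $\rho=\beta+i\gamma$ of the Riemann zeta function $\zeta(s)$ with $0<\gamma\le T$. All counts of zeros are with multiplicity: a zero of multiplicity $m_\rho$ is counted $m_\rho$ times. Let $N(T)$ be the number of these zeros, $N_s(T)$ the number of those that are simple ($m_\rho=1$), $N_0(T)$ the number of those on the critical line ($\beta=\frac12$), and $N_{0,s}(T)$ the number of those that are simple and on the critical line. The Riemann Hypothesis is not assumed. Suppose that there is a constant $C$ with $1\le C<2$ such that, as $T\to\infty$, the number of ordered pairs of zeros on the same horizontal line satisfies $$\sum_{\substack{\rho,\rho'\\ 0<\gamma,\gamma'\le T\\ \gamma=\gamma'}}1\;\le\;\bigl(C+o(1)\bigr)\frac{T}{2\pi}\log T,$$ where $\rho$ and $\rho'$ each run over the zeros repeated according to multiplicity, so that a pair of distinct points $\rho,\rho'$, or the pair $(\rho,\rho)$, contributes $m_\rho m_{\rho'}$. Then, as $T\to\infty$, $$N_s(T)\ge\bigl(2-C+o(1)\bigr)N(T)\qquad\text{and}\qquad N_0(T)\ge\bigl(2-C+o(1)\bigr)N(T).$$ If moreover $C<\frac32$, then also $$N_{0,s}(T)\ge\bigl(3-2C+o(1)\bigr)N(T).$$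 -/

import Mathlib

open Filter Topology

namespace ZetaZeros

/-- A zero of the Riemann zeta function off the real axis has real part in `[0, 1]`. -/
theorem re_mem_Icc {s : ℂ} (h0 : riemannZeta s = 0) (him : s.im ≠ 0) :
    s.re ∈ Set.Icc (0 : ℝ) 1 := by
  constructor
  · by_contra! hre
    have h1 : ∀ n : ℕ, s ≠ -(n : ℂ) := by
      intro n hn
      apply him
      rw [hn]
      simp
    have h2 : s ≠ 1 := by
      intro h
      apply him
      rw [h]
      simp
    have h3 := riemannZeta_one_sub h1 h2
    rw [h0, mul_zero] at h3
    refine riemannZeta_ne_zero_of_one_le_re ?_ h3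
    simp only [Complex.sub_re, Complex.one_re]
    linarith
  · by_contra! hre
    exact riemannZeta_ne_zero_of_one_le_re hre.le h0

/-- There are finitely many zeros of the Riemann zeta function with imaginary part in `(0, T]`. -/
theorem finite_zeros (T : ℝ) :
    {ρ : ℂ | riemannZeta ρ = 0 ∧ 0 < ρ.im ∧ ρ.im ≤ T}.Finite := by
  by_contra hinf
  have hK : IsCompact (Set.Icc (0 : ℝ) 1 ×ℂ Set.Icc (0 : ℝ) T) :=
    isCompact_Icc.reProdIm isCompact_Icc
  have hsub : {ρ : ℂ | riemannZeta ρ = 0 ∧ 0 < ρ.im ∧ ρ.im ≤ T} ⊆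
      Set.Icc (0 : ℝ) 1 ×ℂ Set.Icc (0 : ℝ) T := by
    rintro ρ ⟨h0, h1, h2⟩
    exact ⟨re_mem_Icc h0 h1.ne', h1.le, h2⟩
  obtain ⟨z, -, hz⟩ := Set.Infinite.exists_accPt_of_subset_isCompact hinf hK hsub
  rw [accPt_iff_frequently_nhdsNE] at hz
  have hfr : ∃ᶠ y in 𝓝[≠] z, riemannZeta₁ y = 0 := by
    refine hz.mono ?_
    rintro y ⟨h0, h1, -⟩
    have hy : y ≠ 1 := by
      rintro rfl
      simp at h1
    have h3 := riemannZeta_eq_inv_sub_mul hy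
    rw [h0] at h3
    rcases mul_eq_zero.mp h3.symm with h | h
    · exact absurd (sub_eq_zero.mp (inv_eq_zero.mp h)) hy
    · exact h
  have han : AnalyticOnNhd ℂ riemannZeta₁ Set.univ :=
    fun x _ => differentiable_riemannZeta₁.analyticAt x
  have h4 := han.eq_of_frequently_eq (g := fun _ => (0 : ℂ)) (fun _ _ => analyticAt_const) hfr
  have h5 := congrFun h4 1
  simp [riemannZeta₁_one] at h5

/-- The set (without repetition) of the zeros `ρ = β + iγ` of `ζ` with `0 < γ ≤ T`. -/
noncomputable def zeros (T : ℝ) : Finset ℂ := (finite_zeros T).toFinset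

/-- The multiplicity `m_ρ` of `ρ` as a zero of `ζ`. -/
noncomputable def mult (ρ : ℂ) : ℕ := analyticOrderNatAt riemannZeta ρ

/-- A simple zero of `ζ`. -/
def IsSimple (ρ : ℂ) : Prop := mult ρ = 1

/-- `ρ` lies on the critical line. -/
def OnLine (ρ : ℂ) : Prop := ρ.re = 1 / 2

open Classical in
/-- The number, counted with multiplicity, of the zeros `ρ = β + iγ` of `ζ` with `0 < γ ≤ T`
that have the property `P`. -/
noncomputable def count (P : ℂ → Prop) (T : ℝ) : ℕ := ∑ ρ ∈ zeros T with P ρ, mult ρ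

/-- `N(T)`: the number, counted with multiplicity, of the zeros of `ζ` with `0 < γ ≤ T`. -/
noncomputable def N (T : ℝ) : ℕ := ∑ ρ ∈ zeros T, mult ρ

/-- The number of ordered pairs `(ρ, ρ')` of zeros with `0 < γ, γ' ≤ T` and `γ = γ'`, where each
zero is repeated according to its multiplicity. -/
noncomputable def pairs (T : ℝ) : ℕ :=
  ∑ ρ ∈ zeros T, ∑ ρ' ∈ zeros T with ρ.im = ρ'.im, mult ρ * mult ρ'

end ZetaZeros

/-!
Each of the three bounds is elementary once the number of pairs is compared with `N(T)`. Write `P`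
for the number of pairs. A zero of multiplicity `m` contributes `m ^ 2` to `P` by itself, so
`2 N ≤ N_s + P`. A zero `ρ` off the critical line shares its horizontal line with the zero
`1 - conj ρ`, hence contributes at least `2 m`, so `2 N ≤ N_0 + P`. Finally
`N_0 + N_s ≤ N_{0,s} + N`. Since `P` is bounded in terms of `(T / 2π) log T`, what has to be
supplied is the lower half of the Riemann–von Mangoldt formula,
`(T / 2π) log T ≤ (1 + o(1)) N(T)` (`eventually_mul_log_le_N`).

That bound comes from Jensen's formula. Let `centredXi z` be `s (1 - s) Λ(s)` at `s = 1/2 + z`, an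
entire even function, and let `I(R)` be the mean of `log ‖centredXi‖` on the circle `‖z‖ = R`. By
Jensen's formula `I(R) - I(S) ≤ n(R) log (R / S)`, where `n(R)` counts the zeros in the disc
(`circleAverage_sub_le`), and `n(R) ≤ 2 N(R) + O(1)` (`discCount_le`). If
`I(R) = R log R / π + O(R)`, then `R = (1 + ε) S` gives `2 N(R) ≥ R log R / (π (1 + ε)) - O(R)`
for every `ε > 0`.

For the mean, `log ‖centredXi z‖ ≤ |Re z| / 2 * log ‖z‖ + O(‖z‖)` holds everywhere: it follows from
bounds for the Gamma function where `|Re z| ≥ 3/2`, and from the convergence of the Mellin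
transform that defines `Λ₀` in the strip between. The reverse inequality holds pointwise only where
`|Re z| ≥ 3/2`. Inside the strip, Poisson's inequality for the subharmonic function
`log ‖centredXi‖`, at a point at bounded distance from the arc of the circle in question, shows that
its deviation below the upper bound has mean `O(log R)` only (`exists_le_circleAverage`). This step
asks for circles without zeros, which exist with radius in any interval of length one. As the mean
of `|Re z|` on the circle is `2 R / π`, both bounds have the main term `R log R / π`.
-/

/-! ### Bounds for the Gamma function -/

theorem Complex.norm_Gamma_le_Gamma_re {s : ℂ} (hs : 0 < s.re) :
    ‖Complex.Gamma s‖ ≤ Real.Gamma s.re := by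
  rw [Complex.Gamma_eq_integral hs, Real.Gamma_eq_integral hs, Complex.GammaIntegral]
  refine (MeasureTheory.norm_integral_le_integral_norm _).trans_eq ?_
  refine MeasureTheory.setIntegral_congr_fun measurableSet_Ioi fun x hx ↦ ?_
  rw [Set.mem_Ioi] at hx
  simp [Complex.norm_cpow_eq_rpow_re_of_pos hx, Complex.norm_exp]

/-- The ratio `|Γ(σ + it)| / Γ(σ)` is nondecreasing in `σ`; this is the comparison with `σ = 1`.
In Euler's product each factor `(σ + j) / |σ + j + it|` increases with `σ`. -/
theorem Complex.Gamma_mul_norm_Gamma_one_add_le {s : ℂ} (hs : 1 ≤ s.re) :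
    Real.Gamma s.re * ‖Complex.Gamma (1 + s.im * Complex.I)‖ ≤ ‖Complex.Gamma s‖ := by
  have h1 := (Real.GammaSeq_tendsto_Gamma s.re).mul
    (Complex.GammaSeq_tendsto_Gamma (1 + s.im * Complex.I)).norm
  have h2 := (Complex.GammaSeq_tendsto_Gamma s).norm.mul (Real.GammaSeq_tendsto_Gamma 1)
  rw [Real.Gamma_one, mul_one] at h2
  refine le_of_tendsto_of_tendsto h1 h2 ?_
  filter_upwards [eventually_gt_atTop 0] with n hn
  have hn' : (0 : ℝ) < n := by exact_mod_cast hn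
  simp only [Real.GammaSeq, Complex.GammaSeq, norm_div, norm_mul, norm_prod]
  have e1 : ‖(n : ℂ) ^ s‖ = (n : ℝ) ^ s.re := by
    rw [← Complex.ofReal_natCast, Complex.norm_cpow_eq_rpow_re_of_pos hn']
  have e2 : ‖(n : ℂ) ^ (1 + s.im * Complex.I)‖ = (n : ℝ) ^ (1 : ℝ) := by
    rw [← Complex.ofReal_natCast, Complex.norm_cpow_eq_rpow_re_of_pos hn']
    simp
  have e3 : ‖(n.factorial : ℂ)‖ = n.factorial := by simp
  rw [e1, e2, e3, div_mul_div_comm, div_mul_div_comm, ← Finset.prod_mul_distrib,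
    ← Finset.prod_mul_distrib]
  refine div_le_div_of_nonneg_left (by positivity) ?_ ?_
  · refine Finset.prod_pos fun j _ ↦ mul_pos (norm_pos_iff.mpr fun h ↦ ?_) (by positivity)
    have := congrArg Complex.re h
    simp at this
    have : (0 : ℝ) ≤ j := by positivity
    linarith
  · refine Finset.prod_le_prod (fun j _ ↦ by positivity) fun j _ ↦ ?_
    have hj : (0 : ℝ) ≤ j := by positivity
    refine le_of_sq_le_sq ?_ (by positivity)
    rw [mul_pow, mul_pow, Complex.sq_norm, Complex.sq_norm, Complex.normSq_apply,
      Complex.normSq_apply]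
    simp
    have h : (1 + (j : ℝ)) ^ 2 ≤ (s.re + j) ^ 2 := by gcongr
    nlinarith [mul_le_mul_of_nonneg_left h (mul_self_nonneg s.im)]

/-- The reflection formula and `|Γ(1 - it)| ≤ Γ(1) = 1` bound `Γ(1 + it)` from below. -/
theorem Complex.exp_neg_le_norm_Gamma_one_add (t : ℝ) :
    Real.exp (-(Real.pi * |t|)) ≤ ‖Complex.Gamma (1 + t * Complex.I)‖ := by
  rcases eq_or_ne t 0 with rfl | ht
  · simp
  have hpt : 0 < Real.pi * |t| := mul_pos Real.pi_pos (abs_pos.mpr ht)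
  have htI : (t : ℂ) * Complex.I ≠ 0 := by simp [ht]
  have h1 := Complex.Gamma_mul_Gamma_one_sub (t * Complex.I)
  have h2 : ‖Complex.Gamma (1 - t * Complex.I)‖ ≤ 1 := by
    have := Complex.norm_Gamma_le_Gamma_re (s := 1 - t * Complex.I) (by simp)
    simpa using this
  have h3 : ‖Complex.sin (Real.pi * (t * Complex.I))‖ = Real.sinh (Real.pi * |t|) := by
    rw [← mul_assoc, Complex.sin_mul_I, norm_mul, Complex.norm_I, mul_one, ← Complex.ofReal_mul,
      ← Complex.ofReal_sinh, Complex.norm_real, Real.norm_eq_abs]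
    rcases abs_cases t with ⟨h, h'⟩ | ⟨h, h'⟩
    · rw [h, abs_of_nonneg (Real.sinh_nonneg_iff.mpr (by positivity))]
    · rw [h, abs_of_neg (Real.sinh_neg_iff.mpr (by nlinarith [Real.pi_pos])), mul_neg,
        Real.sinh_neg]
  have h4 : Real.sinh (Real.pi * |t|) ≤ Real.pi * |t| * Real.exp (Real.pi * |t|) := by
    set x := Real.pi * |t|
    rw [Real.sinh_eq]
    have h5 := Real.add_one_le_exp (-(2 * x))
    have h6 : Real.exp (-x) = Real.exp x * Real.exp (-(2 * x)) := by
      rw [← Real.exp_add]; ring_nf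
    rw [h6]
    nlinarith [Real.exp_pos x]
  have h5 : 0 < Real.sinh (Real.pi * |t|) := Real.sinh_pos_iff.mpr hpt
  have h6 : Complex.Gamma (1 + t * Complex.I) =
      t * Complex.I * Complex.Gamma (t * Complex.I) := by
    rw [add_comm, Complex.Gamma_add_one _ htI]
  have h7 : ‖Complex.Gamma (t * Complex.I)‖ * ‖Complex.Gamma (1 - t * Complex.I)‖ =
      Real.pi / Real.sinh (Real.pi * |t|) := by
    rw [← norm_mul, h1, norm_div, h3, Complex.norm_real, Real.norm_eq_abs,
      abs_of_pos Real.pi_pos]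
  rw [h6, norm_mul, norm_mul, Complex.norm_I, mul_one, Complex.norm_real, Real.norm_eq_abs]
  have h8 : Real.pi / Real.sinh (Real.pi * |t|) ≤ ‖Complex.Gamma (t * Complex.I)‖ := by
    rw [← h7]
    exact mul_le_of_le_one_right (norm_nonneg _) h2
  calc Real.exp (-(Real.pi * |t|))
      = Real.pi * |t| / (Real.pi * |t| * Real.exp (Real.pi * |t|)) := by
        rw [Real.exp_neg]; field_simp
    _ ≤ Real.pi * |t| / Real.sinh (Real.pi * |t|) := by gcongr
    _ = |t| * (Real.pi / Real.sinh (Real.pi * |t|)) := by ring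
    _ ≤ _ := by gcongr

/-- The bound `n! ≤ n ^ n`, transferred from the factorial to the Gamma function. -/
theorem Real.Gamma_le_rpow {a R : ℝ} (ha : 1 ≤ a) (hR : a + 1 ≤ R) :
    Real.Gamma a ≤ R ^ (a + 1) := by
  have h1 : Real.Gamma a ≤ Real.Gamma (a + 1) := by
    rw [Real.Gamma_add_one (by positivity)]
    exact le_mul_of_one_le_left (Real.Gamma_pos_of_pos (by positivity)).le ha
  have hc : a ≤ ⌈a⌉₊ := Nat.le_ceil a
  have hc' : (⌈a⌉₊ : ℝ) < a + 1 := Nat.ceil_lt_add_one (by positivity)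
  have h2 : Real.Gamma (a + 1) ≤ Real.Gamma (⌈a⌉₊ + 1) :=
    Real.Gamma_strictMonoOn_Ici.monotoneOn (by simp; linarith) (by simp; linarith) (by linarith)
  rw [Real.Gamma_nat_eq_factorial] at h2
  calc Real.Gamma a ≤ (⌈a⌉₊.factorial : ℝ) := h1.trans h2
    _ ≤ (⌈a⌉₊ : ℝ) ^ ⌈a⌉₊ := by exact_mod_cast Nat.factorial_le_pow _
    _ ≤ R ^ ⌈a⌉₊ := by gcongr; linarith
    _ = R ^ (⌈a⌉₊ : ℝ) := (Real.rpow_natCast _ _).symm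
    _ ≤ R ^ (a + 1) := Real.rpow_le_rpow_of_exponent_le (by linarith) hc'.le

/-- The bound `R ^ k / k! ≤ exp R`, transferred from the factorial to the Gamma function. -/
theorem Real.rpow_mul_exp_neg_le_Gamma_add_two {a R : ℝ} (ha : 0 ≤ a) (hR : 1 ≤ R) :
    R ^ a * Real.exp (-R) ≤ Real.Gamma (a + 2) := by
  set k := ⌊a⌋₊ + 1 with hk
  have hk1 : a ≤ k := by rw [hk]; push_cast; exact (Nat.lt_floor_add_one a).le
  have hk2 : (k : ℝ) ≤ a + 1 := by rw [hk]; push_cast; linarith [Nat.floor_le ha]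
  have h2 : Real.Gamma (k + 1) ≤ Real.Gamma (a + 2) :=
    Real.Gamma_strictMonoOn_Ici.monotoneOn
      (by rw [hk]; simp; linarith [Nat.cast_nonneg (α := ℝ) ⌊a⌋₊])
      (by simp; linarith) (by linarith)
  rw [Real.Gamma_nat_eq_factorial] at h2
  have h3 := Real.pow_div_factorial_le_exp R (by linarith) k
  rw [div_le_iff₀ (by positivity)] at h3
  calc R ^ a * Real.exp (-R) ≤ R ^ (k : ℝ) * Real.exp (-R) := by
        gcongr
    _ = R ^ k * Real.exp (-R) := by rw [Real.rpow_natCast]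
    _ ≤ Real.exp R * k.factorial * Real.exp (-R) := by gcongr
    _ = k.factorial := by rw [mul_right_comm, ← Real.exp_add]; simp
    _ ≤ _ := h2

/-! ### The zeta function to the right of the line `Re s = 2` -/

/-- The terms `n ≥ 2` of the Dirichlet series sum to at most `π ^ 2 / 6 - 1 < 2 / 3`, so `ζ` is
bounded away from `0` and from infinity. -/
theorem norm_riemannZeta_sub_one_le {s : ℂ} (hs : 2 ≤ s.re) :
    ‖riemannZeta s - 1‖ ≤ 2 / 3 := by
  have hs1 : 1 < s.re := by linarith
  have hsum : Summable fun n : ℕ ↦ 1 / ((n : ℂ) + 1) ^ s := by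
    have := (summable_nat_add_iff 1).mpr (Complex.summable_one_div_nat_cpow.mpr hs1)
    simpa using this
  have hsum2 : HasSum (fun n : ℕ ↦ 1 / ((n : ℝ) + 1) ^ 2) (Real.pi ^ 2 / 6) := by
    have := (hasSum_nat_add_iff' (f := fun n : ℕ ↦ 1 / (n : ℝ) ^ 2) 1).mpr hasSum_zeta_two
    simpa using this
  have hsum3 : HasSum (fun n : ℕ ↦ 1 / ((n : ℝ) + 1 + 1) ^ 2) (Real.pi ^ 2 / 6 - 1) := by
    have := (hasSum_nat_add_iff' (f := fun n : ℕ ↦ 1 / ((n : ℝ) + 1) ^ 2) 1).mpr hsum2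
    simpa using this
  rw [zeta_eq_tsum_one_div_nat_add_one_cpow hs1, hsum.tsum_eq_zero_add]
  simp only [Nat.cast_zero, zero_add, Complex.one_cpow, div_one, add_sub_cancel_left]
  have : ‖∑' b : ℕ, 1 / (((b + 1 : ℕ) : ℂ) + 1) ^ s‖ ≤ Real.pi ^ 2 / 6 - 1 := by
    refine tsum_of_norm_bounded hsum3 fun n ↦ ?_
    have hn : (0 : ℝ) < (n : ℝ) + 1 + 1 := by positivity
    have e : (((n + 1 : ℕ) : ℂ) + 1) = (((n : ℝ) + 1 + 1 : ℝ) : ℂ) := by push_cast; ring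
    rw [e, norm_div, norm_one, Complex.norm_cpow_eq_rpow_re_of_pos hn]
    gcongr
    rw [← Real.rpow_natCast]
    exact Real.rpow_le_rpow_of_exponent_le (by linarith [Nat.cast_nonneg (α := ℝ) n])
      (by exact_mod_cast hs)
  have hpi : Real.pi ^ 2 ≤ 3.15 ^ 2 := by
    gcongr
    exact Real.pi_lt_d2.le
  refine this.trans ?_
  linarith

/-! ### The completed zeta function -/

namespace ZetaZeros

/-- The entire function `s (1 - s) Λ(s)`, a constant multiple of Riemann's `ξ`, with the origin
moved to the centre `1/2` of the functional equation. It is written in terms of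
`Λ₀(s) = Λ(s) + 1 / s + 1 / (1 - s)` so that no value has to be fixed at the poles of `Λ`. -/
noncomputable def centredXi (z : ℂ) : ℂ :=
  (1 / 2 + z) * (1 / 2 - z) * completedRiemannZeta₀ (1 / 2 + z) - 1

theorem differentiable_centredXi : Differentiable ℂ centredXi := by
  have := differentiable_completedZeta₀
  unfold centredXi
  fun_prop

theorem centredXi_neg (z : ℂ) : centredXi (-z) = centredXi z := by
  have h := completedRiemannZeta₀_one_sub (1 / 2 + z)
  rw [show (1 : ℂ) - (1 / 2 + z) = 1 / 2 + -z by ring] at h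
  rw [centredXi, h, centredXi]
  ring

theorem centredXi_half : centredXi (1 / 2) = -1 := by
  simp [centredXi]

/-- Away from the poles of `Λ` and of its Gamma factor, `centredXi` is `ζ` times a function without
zeros. -/
theorem centredXi_eq {z : ℂ} (h0 : 1 / 2 + z ≠ 0) (h1 : 1 / 2 - z ≠ 0)
    (hG : Complex.Gammaℝ (1 / 2 + z) ≠ 0) :
    centredXi z =
      (1 / 2 + z) * (1 / 2 - z) * Complex.Gammaℝ (1 / 2 + z) * riemannZeta (1 / 2 + z) := by
  rw [riemannZeta_def_of_ne_zero h0, completedRiemannZeta_eq, centredXi]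
  have h2 : (1 : ℂ) - (1 / 2 + z) = 1 / 2 - z := by ring
  have h3 : (1 / 2 + z) + (1 / 2 - z) = 1 := by ring
  rw [h2, mul_assoc _ (Complex.Gammaℝ _), mul_div_cancel₀ _ hG]
  generalize (1 / 2 + z : ℂ) = a at *
  generalize (1 / 2 - z : ℂ) = b at *
  field_simp
  linear_combination h3

/-- In a vertical strip `Λ₀` is bounded, as it is a Mellin transform that converges everywhere. -/
theorem exists_norm_completedRiemannZeta₀_le :
    ∃ M : ℝ, 0 ≤ M ∧ ∀ s : ℂ, 1 / 2 ≤ s.re → s.re ≤ 2 → ‖completedRiemannZeta₀ s‖ ≤ M := by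
  set P := HurwitzZeta.hurwitzEvenFEPair 0
  have hint : ∀ s : ℂ, MellinConvergent P.f_modif s := fun s ↦
    (P.isStrongFEPair_toStrongFEPair.hasMellin s).1
  have hn : ∀ (s : ℂ), ∀ x ∈ Set.Ioi (0 : ℝ), ‖(x : ℂ) ^ (s - 1) • P.f_modif x‖ =
      x ^ (s.re - 1) * ‖P.f_modif x‖ := by
    intro s x hx
    rw [norm_smul, Complex.norm_cpow_eq_rpow_re_of_pos hx]
    simp
  have hint' : ∀ a : ℝ, MeasureTheory.IntegrableOn (fun x : ℝ ↦ x ^ (a - 1) * ‖P.f_modif x‖)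
      (Set.Ioi 0) := by
    intro a
    refine MeasureTheory.IntegrableOn.congr_fun (hint a).norm (fun x hx ↦ ?_) measurableSet_Ioi
    simpa using hn a x hx
  refine ⟨∫ x in Set.Ioi (0 : ℝ), (x ^ ((1 / 4 : ℝ) - 1) * ‖P.f_modif x‖ +
    x ^ ((1 : ℝ) - 1) * ‖P.f_modif x‖), ?_, fun s h1 h2 ↦ ?_⟩
  · refine MeasureTheory.setIntegral_nonneg measurableSet_Ioi fun x hx ↦ ?_
    rw [Set.mem_Ioi] at hx
    positivity
  · have e : completedRiemannZeta₀ s = mellin P.f_modif (s / 2) / 2 := rfl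
    have hre : (s / 2).re = s.re / 2 := by simp
    have key : ‖mellin P.f_modif (s / 2)‖ ≤
        ∫ x in Set.Ioi (0 : ℝ), (x ^ ((1 / 4 : ℝ) - 1) * ‖P.f_modif x‖ +
          x ^ ((1 : ℝ) - 1) * ‖P.f_modif x‖) := by
      refine (MeasureTheory.norm_integral_le_integral_norm _).trans ?_
      refine MeasureTheory.setIntegral_mono_on (hint _).norm ((hint' _).add (hint' _))
        measurableSet_Ioi fun x hx ↦ ?_
      rw [hn _ x hx, ← add_mul]
      rw [Set.mem_Ioi] at hx
      gcongr
      rcases le_total x 1 with h | h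
      · refine (Real.rpow_le_rpow_of_exponent_ge hx h ?_).trans
          (le_add_of_nonneg_right (by positivity))
        linarith
      · refine (Real.rpow_le_rpow_of_exponent_le h ?_).trans
          (le_add_of_nonneg_left (by positivity))
        linarith
    rw [e, norm_div, Complex.norm_ofNat]
    linarith [norm_nonneg (mellin P.f_modif (s / 2))]

/-! ### Growth of the completed zeta function -/

theorem centredXi_eq_of_re {z : ℂ} (hz : 3 / 2 ≤ z.re) :
    centredXi z = (1 / 2 + z) * (1 / 2 - z) *
      ((Real.pi : ℂ) ^ (-(1 / 2 + z) / 2) * Complex.Gamma ((1 / 2 + z) / 2)) *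
        riemannZeta (1 / 2 + z) := by
  have hre : (1 / 2 + z).re = 1 / 2 + z.re := by simp
  refine centredXi_eq (fun h ↦ ?_) (fun h ↦ ?_) (Complex.Gammaℝ_ne_zero_of_re_pos (by linarith))
  · have := congrArg Complex.re h
    rw [hre, Complex.zero_re] at this
    linarith
  · have := congrArg Complex.re h
    simp at this
    linarith

/-- The upper bound, uniform in the direction of `z`. The zeros of `centredXi` are harmless here,
since `log 0 = 0`. -/
theorem exists_log_norm_centredXi_le :
    ∃ C : ℝ, 0 ≤ C ∧ ∀ z : ℂ, 3 ≤ ‖z‖ →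
      Real.log ‖centredXi z‖ ≤ |z.re| / 2 * Real.log ‖z‖ + C * ‖z‖ := by
  obtain ⟨M, hM0, hM⟩ := exists_norm_completedRiemannZeta₀_le
  refine ⟨M + 5, by positivity, fun z hz ↦ ?_⟩
  wlog hre : 0 ≤ z.re generalizing z
  · have := this (-z) (by simpa using hz) (by simp; linarith)
    simpa [centredXi_neg] using this
  rw [abs_of_nonneg hre]
  set R := ‖z‖ with hR
  have hlog : 0 ≤ Real.log R := Real.log_nonneg (by linarith)
  have hlog' : Real.log R ≤ R - 1 := Real.log_le_sub_one_of_pos (by linarith)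
  have hb : 0 ≤ z.re / 2 * Real.log R + (M + 5) * R := by positivity
  rcases (norm_nonneg (centredXi z)).eq_or_lt with h0 | h0
  · rwa [← h0, Real.log_zero]
  rw [Real.log_le_iff_le_exp h0]
  have ha : ‖1 / 2 + z‖ ≤ R + 1 := (norm_add_le _ _).trans (by norm_num; linarith)
  have hb : ‖1 / 2 - z‖ ≤ R + 1 := (norm_sub_le _ _).trans (by norm_num; linarith)
  have hab : ‖(1 / 2 + z) * (1 / 2 - z)‖ ≤ Real.exp (2 * R) := by
    rw [norm_mul, two_mul, Real.exp_add]
    have := Real.add_one_le_exp R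
    gcongr <;> linarith
  -- In the strip the Gamma factor is not needed: there `centredXi` has polynomial growth.
  rcases le_total z.re (3 / 2) with h | h
  · have h1 := hM (1 / 2 + z) (by simpa using hre) (by simp; linarith)
    have h2 : ‖centredXi z‖ ≤ Real.exp (2 * R) * M + 1 := by
      refine (norm_sub_le _ _).trans ?_
      rw [norm_mul, norm_one]
      gcongr
    have h3 : Real.exp (2 * R) * M + 1 ≤ Real.exp (2 * R) * Real.exp M := by
      have := Real.add_one_le_exp M
      have h4 : 1 ≤ Real.exp (2 * R) := Real.one_le_exp (by linarith)
      nlinarith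
    rw [← Real.exp_add] at h3
    refine (h2.trans h3).trans (Real.exp_le_exp.mpr ?_)
    have : 0 ≤ z.re / 2 * Real.log R := by positivity
    nlinarith
  · have hx : z.re ≤ R := (le_abs_self _).trans (Complex.abs_re_le_norm z)
    have hs : ((1 / 2 + z) / 2).re = z.re / 2 + 1 / 4 := by simp; ring
    have h1 : ‖Complex.Gamma ((1 / 2 + z) / 2)‖ ≤
        Real.exp (Real.log R * (z.re / 2 + 1 / 4 + 1)) := by
      refine (Complex.norm_Gamma_le_Gamma_re (by rw [hs]; linarith)).trans ?_
      rw [hs, ← Real.rpow_def_of_pos (by linarith)]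
      exact Real.Gamma_le_rpow (by linarith) (by linarith)
    have h2 : ‖(Real.pi : ℂ) ^ (-(1 / 2 + z) / 2)‖ ≤ 1 := by
      rw [Complex.norm_cpow_eq_rpow_re_of_pos Real.pi_pos]
      refine Real.rpow_le_one_of_one_le_of_nonpos (by linarith [Real.pi_gt_three]) ?_
      rw [neg_div, Complex.neg_re, hs]
      linarith
    have h3 : ‖riemannZeta (1 / 2 + z)‖ ≤ Real.exp 1 := by
      have := norm_riemannZeta_sub_one_le (s := 1 / 2 + z) (by simp; linarith)
      have h4 := norm_le_norm_sub_add (riemannZeta (1 / 2 + z)) 1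
      rw [norm_one] at h4
      linarith [Real.add_one_le_exp 1]
    rw [centredXi_eq_of_re h, norm_mul, norm_mul _ (_ * Complex.Gamma _),
      norm_mul _ (Complex.Gamma _)]
    calc _ ≤ Real.exp (2 * R) * (1 * Real.exp (Real.log R * (z.re / 2 + 1 / 4 + 1))) *
          Real.exp 1 := by gcongr
      _ = Real.exp (2 * R + Real.log R * (z.re / 2 + 1 / 4 + 1) + 1) := by
        rw [one_mul, Real.exp_add, Real.exp_add]
      _ ≤ _ := Real.exp_le_exp.mpr (by nlinarith)

/-- The matching lower bound, away from the strip that contains the zeros. -/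
theorem exp_le_norm_centredXi {z : ℂ} (hz : 3 ≤ ‖z‖) (hre : 3 / 2 ≤ |z.re|) :
    Real.exp (|z.re| / 2 * Real.log ‖z‖ - 8 * ‖z‖) ≤ ‖centredXi z‖ := by
  wlog h : 0 ≤ z.re generalizing z
  · have := this (z := -z) (by simpa using hz) (by simpa using hre) (by simp; linarith)
    simpa [centredXi_neg] using this
  rw [abs_of_nonneg h] at hre ⊢
  set R := ‖z‖ with hR
  have hlog : 0 ≤ Real.log R := Real.log_nonneg (by linarith)
  have hx : z.re ≤ R := (le_abs_self _).trans (Complex.abs_re_le_norm z)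
  have hs : ((1 / 2 + z) / 2).re = z.re / 2 + 1 / 4 := by simp; ring
  have ha : 1 ≤ ‖1 / 2 + z‖ := by
    refine le_trans ?_ ((le_abs_self _).trans (Complex.abs_re_le_norm _))
    simp; linarith
  have hb : 1 ≤ ‖1 / 2 - z‖ := by
    refine le_trans ?_ ((neg_le_abs _).trans (Complex.abs_re_le_norm _))
    simp; linarith
  have h2 : Real.exp (-(R + 1)) ≤ ‖(Real.pi : ℂ) ^ (-(1 / 2 + z) / 2)‖ := by
    rw [Complex.norm_cpow_eq_rpow_re_of_pos Real.pi_pos, Real.rpow_def_of_pos Real.pi_pos,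
      neg_div, Complex.neg_re, hs]
    refine Real.exp_le_exp.mpr ?_
    have hlpi : Real.log Real.pi ≤ 2 := by
      rw [Real.log_le_iff_le_exp Real.pi_pos]
      have h1 := Real.add_one_le_exp 1
      have h2 : Real.exp 2 = Real.exp 1 * Real.exp 1 := by rw [← Real.exp_add]; norm_num
      nlinarith [Real.pi_le_four]
    nlinarith
  have h3 : Real.exp (-2) ≤ ‖riemannZeta (1 / 2 + z)‖ := by
    have := norm_riemannZeta_sub_one_le (s := 1 / 2 + z) (by simp; linarith)
    have h4 := norm_le_norm_add_norm_sub' 1 (riemannZeta (1 / 2 + z))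
    rw [norm_one, norm_sub_rev] at h4
    have h5 := Real.add_one_le_exp 2
    have h6 : Real.exp (-2) ≤ 1 / 3 := by
      rw [Real.exp_neg, inv_eq_one_div]
      gcongr
      linarith
    linarith
  have h1 : Real.exp (Real.log R * (z.re / 2) - 5 * R) ≤
      ‖Complex.Gamma ((1 / 2 + z) / 2)‖ := by
    refine le_trans ?_ (Complex.Gamma_mul_norm_Gamma_one_add_le (by rw [hs]; linarith))
    have h4 := Complex.exp_neg_le_norm_Gamma_one_add ((1 / 2 + z) / 2).im
    rw [hs]
    set a := z.re / 2 + 1 / 4 with hadef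
    have h5 : Real.exp (Real.log R * (z.re / 2) - 3 * R) ≤ Real.Gamma a := by
      have h6 := Real.rpow_mul_exp_neg_le_Gamma_add_two (a := a) (R := R)
        (by linarith) (by linarith)
      have h7 : Real.Gamma (a + 2) = (a + 1) * (a * Real.Gamma a) := by
        rw [← Real.Gamma_add_one (by linarith), ← Real.Gamma_add_one (by linarith)]
        ring_nf
      have hG := Real.Gamma_pos_of_pos (show 0 < a by linarith)
      have h8 : Real.Gamma (a + 2) ≤ Real.exp (2 * a) * Real.Gamma a := by
        have h9 := Real.add_one_le_exp a
        rw [h7, two_mul, Real.exp_add, ← mul_assoc]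
        gcongr
        linarith
      have h9 := h6.trans h8
      rw [Real.rpow_def_of_pos (by linarith), ← Real.exp_add] at h9
      have h10 : Real.exp (-(2 * a)) * (Real.exp (2 * a) * Real.Gamma a) = Real.Gamma a := by
        rw [← mul_assoc, ← Real.exp_add]; simp
      rw [← h10]
      refine le_trans ?_ (mul_le_mul_of_nonneg_left h9 (Real.exp_pos _).le)
      rw [← Real.exp_add]
      refine Real.exp_le_exp.mpr ?_
      nlinarith
    have him : |((1 / 2 + z) / 2).im| ≤ R / 2 := by
      have : ((1 / 2 + z) / 2).im = z.im / 2 := by simp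
      rw [this, abs_div, abs_two]
      linarith [Complex.abs_im_le_norm z]
    calc Real.exp (Real.log R * (z.re / 2) - 5 * R)
        ≤ Real.exp (Real.log R * (z.re / 2) - 3 * R) *
            Real.exp (-(Real.pi * |((1 / 2 + z) / 2).im|)) := by
          rw [← Real.exp_add]
          refine Real.exp_le_exp.mpr ?_
          nlinarith [Real.pi_le_four, abs_nonneg ((1 / 2 + z) / 2).im]
      _ ≤ _ := by gcongr
  rw [centredXi_eq_of_re hre, norm_mul, norm_mul, norm_mul, norm_mul]
  calc _ ≤ Real.exp (-(R + 1) + (Real.log R * (z.re / 2) - 5 * R) + -2) :=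
        Real.exp_le_exp.mpr (by nlinarith)
    _ = 1 * 1 * (Real.exp (-(R + 1)) * Real.exp (Real.log R * (z.re / 2) - 5 * R)) *
          Real.exp (-2) := by
        rw [Real.exp_add, Real.exp_add]; ring
    _ ≤ _ := by gcongr

end ZetaZeros

/-! ### Poisson's inequality for `log ‖f‖` -/

open Metric Real in
theorem Complex.one_le_norm_canonicalFactor {R : ℝ} {u z : ℂ} (hu : u ∈ ball 0 R)
    (hz : z ∈ closedBall 0 R) (hzu : z ≠ u) : 1 ≤ ‖canonicalFactor R u z‖ := by
  rw [mem_ball_zero_iff] at hu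
  rw [mem_closedBall_zero_iff] at hz
  have hR : 0 < R := (norm_nonneg u).trans_lt hu
  have hzu' : 0 < ‖z - u‖ := norm_pos_iff.mpr (sub_ne_zero.mpr hzu)
  rw [canonicalFactor_apply, norm_div, norm_mul, norm_real, Real.norm_eq_abs, abs_of_pos hR,
    one_le_div (by positivity)]
  refine le_of_sq_le_sq ?_ (norm_nonneg _)
  have e : ‖(R : ℂ) ^ 2 - (starRingEnd ℂ) u * z‖ ^ 2 - (R * ‖z - u‖) ^ 2 =
      (R ^ 2 - ‖u‖ ^ 2) * (R ^ 2 - ‖z‖ ^ 2) := by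
    rw [mul_pow, Complex.sq_norm, Complex.sq_norm, Complex.sq_norm, Complex.sq_norm,
      Complex.normSq_apply, Complex.normSq_apply, Complex.normSq_apply, Complex.normSq_apply,
      ← Complex.ofReal_pow]
    simp only [sub_re, sub_im, mul_re, mul_im, conj_re, conj_im, ofReal_re, ofReal_im]
    ring
  have h1 : 0 ≤ R ^ 2 - ‖u‖ ^ 2 := by
    have : ‖u‖ ^ 2 ≤ R ^ 2 := by gcongr
    linarith
  have h2 : 0 ≤ R ^ 2 - ‖z‖ ^ 2 := by
    have : ‖z‖ ^ 2 ≤ R ^ 2 := by gcongr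
    linarith
  nlinarith [mul_nonneg h1 h2]

open Metric Real Complex in
/-- Dividing out the Blaschke product of its zeros, a function `f` without zeros on the circle
`‖z‖ = R` is majorized on the disc by a zero-free function with the same modulus on the circle. -/
theorem AnalyticOnNhd.exists_zeroFree_majorant {f : ℂ → ℂ} {R : ℝ} (hR : 0 < R)
    (hf : AnalyticOnNhd ℂ f (closedBall 0 R)) (hs : ∀ z ∈ sphere (0 : ℂ) R, f z ≠ 0) :
    ∃ g : ℂ → ℂ, AnalyticOnNhd ℂ g (closedBall 0 R) ∧ (∀ z ∈ closedBall (0 : ℂ) R, g z ≠ 0) ∧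
      (∀ z ∈ sphere (0 : ℂ) R, ‖f z‖ = ‖g z‖) ∧ ∀ z ∈ closedBall (0 : ℂ) R, ‖f z‖ ≤ ‖g z‖ := by
  have hRs : ((R : ℝ) : ℂ) ∈ sphere (0 : ℂ) R := by simp [abs_of_pos hR]
  have htop : ∀ u : closedBall (0 : ℂ) R, meromorphicOrderAt f u ≠ ⊤ := by
    have h1 := (hf.meromorphicOn.exists_meromorphicOrderAt_ne_top_iff_forall
      ⟨nonempty_closedBall.mpr hR.le, (convex_closedBall (0 : ℂ) R).isPreconnected⟩).mp
    refine fun u ↦ h1 ⟨⟨R, sphere_subset_closedBall hRs⟩, ?_⟩ u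
    have h2 := hf _ (sphere_subset_closedBall hRs)
    rw [h2.meromorphicOrderAt_eq, h2.analyticOrderAt_eq_zero.mpr (hs _ hRs)]
    simp
  obtain ⟨g, D⟩ := hf.meromorphicOn.exists_ecanonicalDecomp htop
  have hsphere : ∀ v, MeromorphicOn.divisor f (sphere 0 R) v = 0 := by
    intro v
    by_cases hv : v ∈ sphere (0 : ℂ) R
    · have h2 := hf _ (sphere_subset_closedBall hv)
      rw [MeromorphicOn.AnalyticOnNhd.divisor_apply (hf.mono sphere_subset_closedBall) hv,
        h2.analyticOrderAt_eq_zero.mpr (hs _ hv)]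
      simp
    · exact Function.locallyFinsuppWithin.apply_eq_zero_of_notMem _ hv
  have hfin : (MeromorphicOn.divisor f (ball 0 R)).support.Finite :=
    hf.meromorphicOn.divisor_ball_support_finite
  set B : ℂ → ℂ := ∏ᶠ u, canonicalFactor R u ^ (-MeromorphicOn.divisor f (ball 0 R) u) with hB
  have hBprod : B = ∏ u ∈ hfin.toFinset,
      canonicalFactor R u ^ (-MeromorphicOn.divisor f (ball 0 R) u) := by
    rw [hB]
    refine finprod_eq_prod_of_mulSupport_subset _ fun u hu ↦ ?_
    simp only [Set.Finite.coe_toFinset, Function.mem_support]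
    intro h
    rw [Function.mem_mulSupport, h] at hu
    simp at hu
  have hpt : ∀ z ∈ closedBall (0 : ℂ) R, f z ≠ 0 → f z = B z * g z := by
    intro z hz hfz
    have hB' : AnalyticAt ℂ B z := by
      refine analyticAt_finprod fun a ↦ ?_
      by_cases ha : a ∈ ball 0 R
      · by_cases hza : z = a
        · have h0 : MeromorphicOn.divisor f (ball 0 R) a = 0 := by
            rw [MeromorphicOn.AnalyticOnNhd.divisor_apply (hf.mono ball_subset_closedBall) ha,
              ← hza, (hf z hz).analyticOrderAt_eq_zero.mpr hfz]
            simp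
          rw [h0, neg_zero, zpow_zero]
          exact analyticAt_const
        · exact (analyticOnNhd_canonicalFactor _ _ _ hza).zpow (canonicalFactor_ne_zero ha hz hza)
      · rw [Function.locallyFinsuppWithin.apply_eq_zero_of_notMem _ ha, neg_zero, zpow_zero]
        exact analyticAt_const
    have hBg : AnalyticAt ℂ (B * g) z := hB'.mul (D.analyticOnNhd z hz)
    have heq : f =ᶠ[𝓝[≠] z] B * g := by
      refine MeromorphicAt.eventuallyEq_nhdsNE_of_eventuallyEq_codiscreteWithin_preperfect
        (U := closedBall 0 R) (hf.meromorphicOn z hz) hBg.meromorphicAt hz ?_ ?_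
      · rw [← closure_ball 0 hR.ne']
        exact isOpen_ball.perfect_closure.2
      · have := D.eventuallyEq
        simp only [hsphere, zpow_zero, finprod_one, mul_one] at this
        exact this
    exact ((hf z hz).continuousAt.eventuallyEq_nhds_iff_eventuallyEq_nhdsNE
      hBg.continuousAt |>.mp heq).eq_of_nhds
  have hdiv : ∀ u, 0 ≤ MeromorphicOn.divisor f (ball 0 R) u :=
    (MeromorphicOn.AnalyticOnNhd.divisor_nonneg (hf.mono ball_subset_closedBall))
  have hmem : ∀ u ∈ hfin.toFinset, u ∈ ball (0 : ℂ) R ∧ f u = 0 := by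
    intro u hu
    rw [Set.Finite.mem_toFinset, Function.mem_support] at hu
    have hub : u ∈ ball (0 : ℂ) R := by
      by_contra h
      exact hu (Function.locallyFinsuppWithin.apply_eq_zero_of_notMem _ h)
    refine ⟨hub, ?_⟩
    by_contra h
    rw [MeromorphicOn.AnalyticOnNhd.divisor_apply (hf.mono ball_subset_closedBall) hub,
      (hf u (ball_subset_closedBall hub)).analyticOrderAt_eq_zero.mpr h] at hu
    simp at hu
  refine ⟨g, D.analyticOnNhd, D.ne_zero, fun z hz ↦ ?_, fun z hz ↦ ?_⟩
  · rw [hpt z (sphere_subset_closedBall hz) (hs z hz), norm_mul, hBprod, Finset.prod_apply,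
      norm_prod, Finset.prod_eq_one, one_mul]
    intro u hu
    rw [Pi.pow_apply, norm_zpow, norm_canonicalFactor_eval_circle_eq_one (hmem u hu).1 hz, one_zpow]
  · by_cases h0 : f z = 0
    · rw [h0, norm_zero]; positivity
    rw [hpt z hz h0, norm_mul, hBprod, Finset.prod_apply, norm_prod]
    refine mul_le_of_le_one_left (norm_nonneg _) (Finset.prod_le_one (fun _ _ ↦ norm_nonneg _) ?_)
    intro u hu
    have hzu : z ≠ u := by
      rintro rfl
      exact h0 (hmem z hu).2
    rw [Pi.pow_apply, norm_zpow, zpow_neg]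
    refine inv_le_one_of_one_le₀ (one_le_zpow₀ ?_ (hdiv u))
    exact one_le_norm_canonicalFactor (hmem u hu).1 hz hzu

open Metric Real in
theorem continuousOn_poissonKernel {w : ℂ} {R : ℝ} (hw : w ∈ ball (0 : ℂ) R) :
    ContinuousOn (poissonKernel 0 w) (sphere 0 R) := by
  rw [poissonKernel_eq_re_herglotzRieszKernel]
  have hR : 0 < R := pos_of_mem_ball hw
  have := continuousOn_herglotzRieszKernel_sphere hw
  rw [abs_of_pos hR] at this
  exact Complex.continuous_re.comp_continuousOn this

open Metric Real in
/-- Subharmonicity of `log ‖f‖` with the Poisson kernel as weight. -/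
theorem AnalyticOnNhd.log_norm_le_circleAverage_poissonKernel {f : ℂ → ℂ} {R : ℝ}
    (hf : AnalyticOnNhd ℂ f (closedBall 0 R)) (hs : ∀ z ∈ sphere (0 : ℂ) R, f z ≠ 0)
    {w : ℂ} (hw : w ∈ ball (0 : ℂ) R) (hfw : f w ≠ 0) :
    Real.log ‖f w‖ ≤ circleAverage (fun z ↦ poissonKernel 0 w z * Real.log ‖f z‖) 0 R := by
  have hR : 0 < R := pos_of_mem_ball hw
  obtain ⟨g, hg, hg0, hgs, hgb⟩ := hf.exists_zeroFree_majorant hR hs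
  have h1 := InnerProductSpace.HarmonicOnNhd.circleAverage_poissonKernel_smul
    (f := fun z ↦ Real.log ‖g z‖) (fun z hz ↦ (hg z hz).harmonicAt_log_norm (hg0 z hz)) hw
  have h2 : circleAverage (fun z ↦ poissonKernel 0 w z * Real.log ‖f z‖) 0 R =
      circleAverage (poissonKernel 0 w • fun z ↦ Real.log ‖g z‖) 0 R := by
    refine circleAverage_congr_sphere fun z hz ↦ ?_
    rw [abs_of_pos hR] at hz
    simp [hgs z hz]
  rw [h2, h1]
  exact Real.log_le_log (norm_pos_iff.mpr hfw) (hgb w (ball_subset_closedBall hw))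

open Metric Real in
theorem circleAverage_poissonKernel_eq_one {w : ℂ} {R : ℝ} (hw : w ∈ ball (0 : ℂ) R) :
    circleAverage (poissonKernel 0 w) 0 R = 1 := by
  have h1 := InnerProductSpace.HarmonicOnNhd.circleAverage_poissonKernel_smul
    (f := fun _ ↦ (1 : ℝ)) (fun z _ ↦ InnerProductSpace.harmonicAt_const 1) hw
  rw [← h1]
  congr 1
  ext z
  simp

/-! ### The mean of `|Re z|` on a circle -/

open Real in
theorem integral_abs_cos_two_pi : ∫ θ in (0 : ℝ)..2 * π, |cos θ| = 4 := by
  have hp : Function.Periodic (fun θ ↦ |cos θ|) π := fun θ ↦ by simp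
  have hc : Continuous fun θ : ℝ ↦ |cos θ| := by fun_prop
  have h1 : ∀ t, ∫ θ in t..t + π, |cos θ| = 2 := by
    intro t
    rw [hp.intervalIntegral_add_eq t (-(π / 2))]
    have : ∫ θ in (-(π / 2))..(-(π / 2) + π), |cos θ| = ∫ θ in (-(π / 2))..(π / 2), cos θ := by
      rw [show -(π / 2) + π = π / 2 by ring]
      refine intervalIntegral.integral_congr fun θ hθ ↦ ?_
      rw [Set.uIcc_of_le (by linarith [pi_pos])] at hθ
      exact abs_of_nonneg (cos_nonneg_of_mem_Icc hθ)
    rw [this, integral_cos]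
    simp
    norm_num
  rw [← intervalIntegral.integral_add_adjacent_intervals (hc.intervalIntegrable 0 (0 + π))
    (hc.intervalIntegrable (0 + π) (2 * π)), h1 0,
    show (2 * π : ℝ) = 0 + π + π by ring, h1 (0 + π)]
  norm_num

open Real in
theorem circleAverage_abs_re {R : ℝ} (hR : 0 ≤ R) :
    circleAverage (fun z : ℂ ↦ |z.re|) 0 R = 2 * R / π := by
  have : ∀ θ : ℝ, |(circleMap 0 R θ).re| = R * |cos θ| := by
    intro θ
    rw [circleMap_zero_re, abs_mul, abs_of_nonneg hR]
  rw [circleAverage]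
  simp only [this]
  rw [intervalIntegral.integral_const_mul, integral_abs_cos_two_pi, smul_eq_mul]
  field_simp
  ring

namespace ZetaZeros

/-! ### Circle means of the completed zeta function -/

open Real in
theorem circleAverage_abs_re_mul_add {R : ℝ} (hR : 0 ≤ R) (a b : ℝ) :
    circleAverage (fun z : ℂ ↦ |z.re| / 2 * a + b) 0 R = R * a / π + b := by
  have h1 : (fun z : ℂ ↦ |z.re| / 2 * a + b) = fun z : ℂ ↦ (a / 2) • |z.re| + b := by
    ext z
    rw [smul_eq_mul]
    ring
  have hi : CircleIntegrable (fun z : ℂ ↦ (a / 2) • |z.re|) 0 R :=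
    (Continuous.continuousOn (by fun_prop)).circleIntegrable hR
  rw [h1, circleAverage_fun_add hi (continuousOn_const.circleIntegrable hR), circleAverage_fun_smul,
    circleAverage_abs_re hR, circleAverage_const, smul_eq_mul]
  field_simp

open Real in
theorem circleIntegrable_log_norm_centredXi (R : ℝ) :
    CircleIntegrable (fun z ↦ Real.log ‖centredXi z‖) 0 R :=
  MeromorphicOn.circleIntegrable_log_norm fun z _ ↦
    (differentiable_centredXi.analyticAt z).meromorphicAt

open Real in
theorem exists_circleAverage_le :
    ∃ C : ℝ, 0 ≤ C ∧ ∀ R : ℝ, 3 ≤ R →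
      circleAverage (fun z ↦ Real.log ‖centredXi z‖) 0 R ≤ R * Real.log R / π + C * R := by
  obtain ⟨C, hC0, hC⟩ := exists_log_norm_centredXi_le
  refine ⟨C, hC0, fun R hR ↦ ?_⟩
  have hR0 : 0 ≤ R := by linarith
  rw [← circleAverage_abs_re_mul_add hR0]
  refine circleAverage_mono (circleIntegrable_log_norm_centredXi R)
    (Continuous.continuousOn (by fun_prop) |>.circleIntegrable hR0) fun z hz ↦ ?_
  rw [abs_of_nonneg hR0, mem_sphere_zero_iff_norm] at hz
  have := hC z (by rwa [hz])
  rwa [hz] at this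

/-- A point at bounded distance from the arc of the circle `‖z‖ = R` in the upper half of the
strip `|Re z| ≤ 3/2`, lying outside that strip and at distance about `3` from the circle. -/
noncomputable def arcPoint (R : ℝ) : ℂ := ⟨2, R - 3⟩

theorem norm_sq_arcPoint (R : ℝ) : ‖arcPoint R‖ ^ 2 = 4 + (R - 3) ^ 2 := by
  rw [Complex.sq_norm, Complex.normSq_apply, arcPoint]
  ring

theorem arcPoint_mem_ball {R : ℝ} (hR : 9 ≤ R) : arcPoint R ∈ Metric.ball (0 : ℂ) R := by
  rw [mem_ball_zero_iff]
  refine lt_of_pow_lt_pow_left₀ 2 (by linarith) ?_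
  rw [norm_sq_arcPoint]
  nlinarith

theorem three_le_norm_arcPoint {R : ℝ} (hR : 9 ≤ R) : 3 ≤ ‖arcPoint R‖ := by
  refine le_of_sq_le_sq ?_ (norm_nonneg _)
  rw [norm_sq_arcPoint]
  nlinarith

theorem poissonKernel_conj (w z : ℂ) :
    poissonKernel 0 (starRingEnd ℂ w) z = poissonKernel 0 w (starRingEnd ℂ z) := by
  simp only [poissonKernel, sub_zero, Complex.norm_conj]
  rw [← Complex.norm_conj (z - _), map_sub, Complex.conj_conj]

theorem poissonKernel_nonneg_of_mem {R : ℝ} {w z : ℂ} (hw : w ∈ Metric.ball (0 : ℂ) R)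
    (hz : ‖z‖ = R) : 0 ≤ poissonKernel 0 w z := by
  rw [mem_ball_zero_iff] at hw
  rw [poissonKernel, sub_zero, sub_zero, hz]
  refine div_nonneg (sub_nonneg.mpr ?_) (by positivity)
  gcongr

theorem le_poissonKernel_arcPoint {R : ℝ} (hR : 9 ≤ R) {z : ℂ} (hz : ‖z‖ = R)
    (hre : |z.re| ≤ 3 / 2) (him : 0 ≤ z.im) : R / 50 ≤ poissonKernel 0 (arcPoint R) z := by
  have hsq : z.re ^ 2 + z.im ^ 2 = R ^ 2 := by
    rw [← hz, Complex.sq_norm, Complex.normSq_apply]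
    ring
  obtain ⟨h1, h2⟩ := abs_le.mp hre
  have h3 : z.im ≤ R := by nlinarith
  have h4 : R - 1 ≤ z.im := by nlinarith
  have hd : ‖z - arcPoint R‖ ^ 2 = (z.re - 2) ^ 2 + (z.im - (R - 3)) ^ 2 := by
    rw [Complex.sq_norm, Complex.normSq_apply, arcPoint]
    simp
    ring
  rw [poissonKernel, sub_zero, sub_zero, hz, norm_sq_arcPoint, hd]
  have h5 : 0 < (z.re - 2) ^ 2 + (z.im - (R - 3)) ^ 2 := by nlinarith
  have h6 : (z.re - 2) ^ 2 + (z.im - (R - 3)) ^ 2 ≤ 50 := by nlinarith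
  rw [div_le_div_iff₀ (by norm_num) h5]
  nlinarith

theorem exists_log_norm_centredXi_ge :
    ∃ C : ℝ, 0 ≤ C ∧ ∀ z : ℂ, 3 ≤ ‖z‖ → 3 / 2 ≤ |z.re| →
      |z.re| / 2 * Real.log ‖z‖ - C * ‖z‖ ≤ Real.log ‖centredXi z‖ := by
  refine ⟨8, by norm_num, fun z hz hre ↦ ?_⟩
  have h1 := exp_le_norm_centredXi hz hre
  exact (Real.le_log_iff_exp_le ((Real.exp_pos _).trans_le h1)).mpr h1

open Real in
/-- On the two short arcs where `|Re z| ≤ 3/2` there is no pointwise lower bound for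
`log ‖centredXi‖`. Its negative part there is controlled by Poisson's inequality at two points
close to these arcs, whose kernels are at least `R / 50` on them. -/
theorem exists_le_circleAverage :
    ∃ C : ℝ, 0 ≤ C ∧ ∀ R : ℝ, 9 ≤ R → (∀ z ∈ Metric.sphere (0 : ℂ) R, centredXi z ≠ 0) →
      R * Real.log R / π - C * R ≤ circleAverage (fun z ↦ Real.log ‖centredXi z‖) 0 R := by
  obtain ⟨C, hC0, hC⟩ := exists_log_norm_centredXi_le
  obtain ⟨C', hC'0, hC'⟩ := exists_log_norm_centredXi_ge
  refine ⟨(C' + 1) + 50 + 100 * C + 100 * C', by positivity, fun R hR hs ↦ ?_⟩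
  have hR0 : 0 ≤ R := by linarith
  have hRpos : 0 < R := by linarith
  have hlog : 0 ≤ Real.log R := Real.log_nonneg (by linarith)
  have hlog' : Real.log R ≤ R - 1 := Real.log_le_sub_one_of_pos hRpos
  have hmem : ∀ z ∈ Metric.sphere (0 : ℂ) |R|, ‖z‖ = R := fun z hz ↦ by
    rwa [abs_of_nonneg hR0, mem_sphere_zero_iff_norm] at hz
  set u : ℂ → ℝ := fun z ↦ Real.log ‖centredXi z‖ with hu
  set w := arcPoint R
  set w' := starRingEnd ℂ w
  set B := R / 2 * Real.log R + C * R with hB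
  have hw : w ∈ Metric.ball (0 : ℂ) R := arcPoint_mem_ball hR
  have hw' : w' ∈ Metric.ball (0 : ℂ) R := by
    simpa [w'] using hw
  have hufun : ContinuousOn u (Metric.sphere 0 R) := by
    intro z hz
    exact (differentiable_centredXi.continuous.norm.continuousAt.log
      (norm_ne_zero_iff.mpr (hs z hz))).continuousWithinAt
  have huB : ∀ z : ℂ, ‖z‖ = R → u z ≤ B := by
    intro z hz
    have h1 := hC z (by linarith)
    have h2 := Complex.abs_re_le_norm z
    rw [hz] at h1 h2
    refine h1.trans ?_
    rw [hB]
    gcongr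
  -- Poisson's inequality at `v`, as a bound for the mean of the deficit `B - u`.
  have hpoint : ∀ v ∈ Metric.ball (0 : ℂ) R, 3 ≤ ‖v‖ → 3 / 2 ≤ |v.re| →
      CircleIntegrable (fun z ↦ poissonKernel 0 v z * (B - u z)) 0 R ∧
      circleAverage (fun z ↦ poissonKernel 0 v z * (B - u z)) 0 R ≤ B + C' * R := by
    intro v hv hv3 hvre
    have h1 := hC' v hv3 hvre
    have hxv : centredXi v ≠ 0 :=
      norm_pos_iff.mp ((Real.exp_pos _).trans_le (exp_le_norm_centredXi hv3 hvre))
    have h2 := AnalyticOnNhd.log_norm_le_circleAverage_poissonKernel (f := centredXi)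
      (fun z _ ↦ differentiable_centredXi.analyticAt z) hs hv hxv
    have hP := continuousOn_poissonKernel hv
    have h3 : (fun z ↦ poissonKernel 0 v z * (B - u z)) =
        fun z ↦ B • poissonKernel 0 v z - poissonKernel 0 v z * u z := by
      ext z
      rw [smul_eq_mul]
      ring
    have hi1 : CircleIntegrable (fun z ↦ B • poissonKernel 0 v z) 0 R :=
      (hP.const_smul B).circleIntegrable hR0
    have hi2 : CircleIntegrable (fun z ↦ poissonKernel 0 v z * u z) 0 R :=
      (hP.mul hufun).circleIntegrable hR0
    refine ⟨(hP.mul (continuousOn_const.sub hufun)).circleIntegrable hR0, ?_⟩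
    rw [h3, circleAverage_fun_sub hi1 hi2, circleAverage_fun_smul,
      circleAverage_poissonKernel_eq_one hv, smul_eq_mul, mul_one]
    have h4 : 0 ≤ |v.re| / 2 * Real.log ‖v‖ := by
      have := Real.log_nonneg (show 1 ≤ ‖v‖ by linarith)
      positivity
    have h5 : C' * ‖v‖ ≤ C' * R := by
      rw [mem_ball_zero_iff] at hv
      gcongr
    linarith
  have hre : w.re = 2 := rfl
  have hre' : w'.re = 2 := by simp [w', hre]
  obtain ⟨hi1, ha1⟩ := hpoint w hw (three_le_norm_arcPoint hR) (by rw [hre]; norm_num)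
  obtain ⟨hi2, ha2⟩ := hpoint w' hw' (by simpa [w'] using three_le_norm_arcPoint hR)
    (by rw [hre']; norm_num)
  -- Outside the strip this is the pointwise bound. Inside, the kernel term is at least `B - u z`, and
  -- `B` is nonnegative while the main term is at most `R`.
  have hptw : ∀ z ∈ Metric.sphere (0 : ℂ) |R|,
      |z.re| / 2 * Real.log R + -((C' + 1) * R) ≤ u z + (50 / R) •
        (poissonKernel 0 w z * (B - u z) + poissonKernel 0 w' z * (B - u z)) := by
    intro z hz
    have hz := hmem z hz
    have hBu : 0 ≤ B - u z := sub_nonneg.mpr (huB z hz)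
    have hP := poissonKernel_nonneg_of_mem hw hz
    have hP' := poissonKernel_nonneg_of_mem hw' hz
    rw [smul_eq_mul]
    rcases le_total (3 / 2) |z.re| with h | h
    · have h1 := hC' z (by linarith) h
      rw [hz] at h1
      have : 0 ≤ 50 / R * (poissonKernel 0 w z * (B - u z) + poissonKernel 0 w' z * (B - u z)) := by
        positivity
      have h2 : |z.re| / 2 * Real.log R - C' * R ≤ u z := h1
      linarith
    · have hPP : R / 50 ≤ poissonKernel 0 w z + poissonKernel 0 w' z := by
        rcases le_total 0 z.im with him | him
        · linarith [le_poissonKernel_arcPoint hR hz h him]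
        · have := le_poissonKernel_arcPoint hR (z := starRingEnd ℂ z) (by simpa using hz)
            (by simpa using h) (by simpa using him)
          rw [← poissonKernel_conj] at this
          linarith
      have h1 : 50 / R * (R / 50 * (B - u z)) ≤ 50 / R *
          (poissonKernel 0 w z * (B - u z) + poissonKernel 0 w' z * (B - u z)) := by
        rw [← add_mul]
        gcongr
      have h2 : 50 / R * (R / 50 * (B - u z)) = B - u z := by field_simp
      have h3 : |z.re| / 2 * Real.log R ≤ R := by nlinarith [abs_nonneg z.re]
      have h4 : 0 ≤ B := by positivity
      have h5 : 0 ≤ C' * R := by positivity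
      nlinarith
  have hiu := circleIntegrable_log_norm_centredXi R
  have hi3 : CircleIntegrable
      (fun z ↦ poissonKernel 0 w z * (B - u z) + poissonKernel 0 w' z * (B - u z)) 0 R :=
    hi1.add hi2
  have hi4 : CircleIntegrable (fun z ↦ (50 / R) •
        (poissonKernel 0 w z * (B - u z) + poissonKernel 0 w' z * (B - u z))) 0 R :=
    hi3.const_smul
  have hmono := circleAverage_mono
    ((Continuous.continuousOn (by fun_prop)).circleIntegrable hR0) (hiu.add hi4) hptw
  rw [circleAverage_abs_re_mul_add hR0] at hmono
  have hsum : circleAverage (u + fun z ↦ (50 / R) •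
      (poissonKernel 0 w z * (B - u z) + poissonKernel 0 w' z * (B - u z))) 0 R ≤
      circleAverage u 0 R + 50 / R * (2 * (B + C' * R)) := by
    rw [circleAverage_add hiu hi4, circleAverage_fun_smul, circleAverage_fun_add hi1 hi2,
      smul_eq_mul]
    gcongr
    linarith
  have hfin : 50 / R * (2 * (B + C' * R)) = 50 * Real.log R + 100 * C + 100 * C' := by
    rw [hB]
    field_simp
    ring
  have h6 := hmono.trans hsum
  rw [hfin] at h6
  nlinarith

/-! ### Counting the zeros of the completed zeta function -/

theorem analyticOrderAt_centredXi_ne_top (z : ℂ) : analyticOrderAt centredXi z ≠ ⊤ := by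
  refine AnalyticOnNhd.analyticOrderAt_ne_top_of_isPreconnected (U := Set.univ) (x := 1 / 2)
    (fun z _ ↦ differentiable_centredXi.analyticAt z) isPreconnected_univ trivial trivial ?_
  rw [(differentiable_centredXi.analyticAt _).analyticOrderAt_eq_zero.mpr
    (by rw [centredXi_half]; norm_num)]
  simp

theorem divisor_centredXi {R : ℝ} {z : ℂ} (hz : z ∈ Metric.closedBall (0 : ℂ) R) :
    MeromorphicOn.divisor centredXi (Metric.closedBall 0 R) z =
      (analyticOrderNatAt centredXi z : ℤ) := by
  rw [MeromorphicOn.AnalyticOnNhd.divisor_apply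
    (fun z _ ↦ differentiable_centredXi.analyticAt z) hz,
    ← Nat.cast_analyticOrderNatAt (analyticOrderAt_centredXi_ne_top z)]
  rfl

theorem analyticOrderNatAt_centredXi_ne_zero_iff {z : ℂ} :
    analyticOrderNatAt centredXi z ≠ 0 ↔ centredXi z = 0 := by
  rw [← (differentiable_centredXi.analyticAt z).analyticOrderAt_ne_zero,
    ← Nat.cast_analyticOrderNatAt (analyticOrderAt_centredXi_ne_top z)]
  norm_cast

theorem support_divisor_centredXi (R : ℝ) :
    (MeromorphicOn.divisor centredXi (Metric.closedBall 0 R)).support =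
      {z | centredXi z = 0 ∧ ‖z‖ ≤ R} := by
  ext z
  rw [Function.mem_support, Set.mem_ofPred_eq, ← mem_closedBall_zero_iff]
  by_cases hz : z ∈ Metric.closedBall (0 : ℂ) R
  · rw [divisor_centredXi hz, ← analyticOrderNatAt_centredXi_ne_zero_iff]
    simp only [hz, and_true]
    norm_cast
  · simp only [hz, and_false, iff_false, not_not]
    exact Function.locallyFinsuppWithin.apply_eq_zero_of_notMem _ hz

theorem finite_zeros_centredXi (R : ℝ) : {z : ℂ | centredXi z = 0 ∧ ‖z‖ ≤ R}.Finite := by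
  rw [← support_divisor_centredXi]
  exact (MeromorphicOn.divisor centredXi _).finiteSupport (isCompact_closedBall 0 R)

/-- The zeros of `centredXi` in the closed disc of radius `R` about the origin. -/
noncomputable def discZeros (R : ℝ) : Finset ℂ := (finite_zeros_centredXi R).toFinset

theorem mem_discZeros {R : ℝ} {z : ℂ} : z ∈ discZeros R ↔ centredXi z = 0 ∧ ‖z‖ ≤ R := by
  simp [discZeros]

/-- The number, with multiplicity, of the zeros of `centredXi` in the closed disc of radius `R`. -/
noncomputable def discCount (R : ℝ) : ℕ := ∑ z ∈ discZeros R, analyticOrderNatAt centredXi z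

open Real in
/-- Jensen's formula. A zero at the origin contributes its order times `log R`, in accordance with
the convention `log 0 = 0`. -/
theorem circleAverage_eq_sum {R : ℝ} (hR : 0 < R) :
    circleAverage (fun z ↦ Real.log ‖centredXi z‖) 0 R =
      ∑ z ∈ discZeros R, analyticOrderNatAt centredXi z * (Real.log R - Real.log ‖z‖) +
        Real.log ‖meromorphicTrailingCoeffAt centredXi 0‖ := by
  rw [MeromorphicOn.circleAverage_log_norm hR.ne'
    (fun z _ ↦ (differentiable_centredXi.analyticAt z).meromorphicAt), abs_of_pos hR,
    ← countingFunction_finsum_eq_finsum_add hR.ne'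
      ((MeromorphicOn.divisor centredXi _).finiteSupport (isCompact_closedBall 0 R)),
    finsum_eq_sum_of_support_subset (s := discZeros R)]
  · congr 1
    refine Finset.sum_congr rfl fun z hz ↦ ?_
    rw [divisor_centredXi (mem_closedBall_zero_iff.mpr (mem_discZeros.mp hz).2), zero_sub,
      norm_neg]
    norm_cast
  · intro z hz
    rw [discZeros, Set.Finite.coe_toFinset, ← support_divisor_centredXi]
    rw [Function.mem_support] at hz ⊢
    intro h
    rw [h] at hz
    simp at hz

open Real in
/-- Each zero in the larger disc contributes at most `log (S / R)` to the increase of the mean. -/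
theorem circleAverage_sub_le {R S : ℝ} (hR : 0 < R) (hRS : R ≤ S) :
    circleAverage (fun z ↦ Real.log ‖centredXi z‖) 0 S -
      circleAverage (fun z ↦ Real.log ‖centredXi z‖) 0 R ≤
        discCount S * (Real.log S - Real.log R) := by
  have hsub : discZeros R ⊆ discZeros S := fun z hz ↦ by
    rw [mem_discZeros] at hz ⊢
    exact ⟨hz.1, hz.2.trans hRS⟩
  rw [circleAverage_eq_sum hR, circleAverage_eq_sum (hR.trans_le hRS),
    ← Finset.sum_sdiff hsub, discCount, Nat.cast_sum, Finset.sum_mul, ← Finset.sum_sdiff hsub]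
  have h1 : ∑ z ∈ discZeros S \ discZeros R,
      (analyticOrderNatAt centredXi z : ℝ) * (Real.log S - Real.log ‖z‖) ≤
      ∑ z ∈ discZeros S \ discZeros R,
        (analyticOrderNatAt centredXi z : ℝ) * (Real.log S - Real.log R) := by
    refine Finset.sum_le_sum fun z hz ↦ ?_
    rw [Finset.mem_sdiff, mem_discZeros, mem_discZeros] at hz
    have : R < ‖z‖ := by
      by_contra! h
      exact hz.2 ⟨hz.1.1, h⟩
    have := Real.log_le_log hR this.le
    gcongr
  have h2 : ∑ z ∈ discZeros R,
      (analyticOrderNatAt centredXi z : ℝ) * (Real.log S - Real.log ‖z‖) -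
      ∑ z ∈ discZeros R, (analyticOrderNatAt centredXi z : ℝ) * (Real.log R - Real.log ‖z‖) =
      ∑ z ∈ discZeros R, (analyticOrderNatAt centredXi z : ℝ) * (Real.log S - Real.log R) := by
    rw [← Finset.sum_sub_distrib]
    exact Finset.sum_congr rfl fun z _ ↦ by ring
  linarith

theorem Gammaℝ_ne_zero_of_im_ne_zero {s : ℂ} (hs : s.im ≠ 0) : Complex.Gammaℝ s ≠ 0 := by
  rw [Ne, Complex.Gammaℝ_eq_zero_iff]
  rintro ⟨n, rfl⟩
  simp at hs

theorem half_add_ne_zero {z : ℂ} (hz : z.im ≠ 0) : 1 / 2 + z ≠ 0 := fun h ↦ hz <| by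
  simpa using congrArg Complex.im h

theorem half_sub_ne_zero {z : ℂ} (hz : z.im ≠ 0) : 1 / 2 - z ≠ 0 := fun h ↦ hz <| by
  simpa using congrArg Complex.im h

theorem analyticAt_Gammaℝ {s : ℂ} (hs : s.im ≠ 0) : AnalyticAt ℂ Complex.Gammaℝ s := by
  have he : Complex.Gammaℝ = (fun s ↦ (Complex.Gammaℝ s)⁻¹)⁻¹ := by
    ext
    simp
  rw [he]
  exact (Complex.differentiable_Gammaℝ_inv.analyticAt s).inv
    (inv_ne_zero (Gammaℝ_ne_zero_of_im_ne_zero hs))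

theorem analyticAt_riemannZeta {s : ℂ} (hs : s.im ≠ 0) : AnalyticAt ℂ riemannZeta s :=
  analyticOn_riemannZeta s fun h ↦ hs (by rw [Set.mem_singleton_iff.mp h]; simp)

/-- Off the real axis, the zeros of `centredXi` are those of `ζ`, with the same multiplicities. -/
theorem analyticOrderNatAt_centredXi {z : ℂ} (hz : z.im ≠ 0) :
    analyticOrderNatAt centredXi z = mult (1 / 2 + z) := by
  have him : (1 / 2 + z).im ≠ 0 := by simpa using hz
  have hshift : AnalyticAt ℂ (fun y : ℂ ↦ 1 / 2 + y) z := by fun_prop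
  have hζ : AnalyticAt ℂ (fun y ↦ riemannZeta (1 / 2 + y)) z :=
    (analyticAt_riemannZeta him).comp hshift
  have hh : AnalyticAt ℂ (fun y ↦ (1 / 2 + y) * (1 / 2 - y) * Complex.Gammaℝ (1 / 2 + y)) z := by
    have : AnalyticAt ℂ (fun y ↦ Complex.Gammaℝ (1 / 2 + y)) z :=
      (analyticAt_Gammaℝ him).comp hshift
    fun_prop
  have heq : centredXi =ᶠ[𝓝 z] (fun y ↦ (1 / 2 + y) * (1 / 2 - y) * Complex.Gammaℝ (1 / 2 + y)) *
      fun y ↦ riemannZeta (1 / 2 + y) := by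
    filter_upwards [Complex.continuous_im.continuousAt.eventually_ne hz] with y hy
    exact centredXi_eq (half_add_ne_zero hy) (half_sub_ne_zero hy)
      (Gammaℝ_ne_zero_of_im_ne_zero (by simpa using hy))
  have h0 : analyticOrderAt
      (fun y ↦ (1 / 2 + y) * (1 / 2 - y) * Complex.Gammaℝ (1 / 2 + y)) z = 0 := by
    rw [hh.analyticOrderAt_eq_zero]
    exact mul_ne_zero (mul_ne_zero (half_add_ne_zero hz) (half_sub_ne_zero hz))
      (Gammaℝ_ne_zero_of_im_ne_zero him)
  have hcomp : analyticOrderAt (riemannZeta ∘ fun y ↦ 1 / 2 + y) z =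
      analyticOrderAt riemannZeta (1 / 2 + z) := by
    refine analyticOrderAt_comp_of_deriv_ne_zero hshift ?_
    simp
  rw [mult, analyticOrderNatAt, analyticOrderNatAt, analyticOrderAt_congr heq,
    analyticOrderAt_mul hh hζ, h0, zero_add]
  exact congrArg _ hcomp

theorem analyticOrderNatAt_centredXi_neg (z : ℂ) :
    analyticOrderNatAt centredXi (-z) = analyticOrderNatAt centredXi z := by
  have hcomp : analyticOrderAt (centredXi ∘ fun y ↦ -y) z = analyticOrderAt centredXi (-z) := by
    refine analyticOrderAt_comp_of_deriv_ne_zero (by fun_prop) ?_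
    simp
  have he : (centredXi ∘ fun y ↦ -y) = centredXi := funext centredXi_neg
  rw [analyticOrderNatAt, ← hcomp, he, analyticOrderNatAt]

theorem abs_re_le_of_centredXi_eq_zero {z : ℂ} (hz : centredXi z = 0) : |z.re| ≤ 1 / 2 := by
  wlog h : 0 ≤ z.re generalizing z
  · simpa using this (z := -z) (by rwa [centredXi_neg]) (by simp; linarith)
  rw [abs_of_nonneg h]
  by_contra! hlt
  have h1 : (1 / 2 + z).re = 1 / 2 + z.re := by simp
  rw [centredXi_eq (fun h0 ↦ ?_) (fun h0 ↦ ?_)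
    (Complex.Gammaℝ_ne_zero_of_re_pos (by rw [h1]; linarith))] at hz
  · have h2 : (1 / 2 + z : ℂ) ≠ 0 := fun h0 ↦ by
      rw [h0, Complex.zero_re] at h1
      linarith
    have h3 : (1 / 2 - z : ℂ) ≠ 0 := fun h0 ↦ by
      have := congrArg Complex.re h0
      simp at this
      linarith
    exact mul_ne_zero (mul_ne_zero (mul_ne_zero h2 h3)
      (Complex.Gammaℝ_ne_zero_of_re_pos (by rw [h1]; linarith)))
      (riemannZeta_ne_zero_of_one_le_re (by rw [h1]; linarith)) hz
  · rw [h0, Complex.zero_re] at h1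
    linarith
  · have := congrArg Complex.re h0
    simp at this
    linarith

theorem mem_zeros {T : ℝ} {ρ : ℂ} :
    ρ ∈ zeros T ↔ riemannZeta ρ = 0 ∧ 0 < ρ.im ∧ ρ.im ≤ T := by
  simp [zeros]

theorem half_add_mem_zeros {T : ℝ} {z : ℂ} (hz : z ∈ discZeros T) (him : 0 < z.im) :
    1 / 2 + z ∈ zeros T := by
  rw [mem_discZeros] at hz
  refine mem_zeros.mpr ⟨?_, by simpa using him, ?_⟩
  · have h := hz.1
    rw [centredXi_eq (half_add_ne_zero him.ne') (half_sub_ne_zero him.ne')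
      (Gammaℝ_ne_zero_of_im_ne_zero (by simpa using him.ne'))] at h
    exact (mul_eq_zero.mp h).resolve_left (mul_ne_zero (mul_ne_zero (half_add_ne_zero him.ne')
      (half_sub_ne_zero him.ne')) (Gammaℝ_ne_zero_of_im_ne_zero (by simpa using him.ne')))
  · have := (le_abs_self _).trans (Complex.abs_im_le_norm z)
    simpa using this.trans hz.2

theorem sum_im_pos_le (T : ℝ) :
    ∑ z ∈ discZeros T with 0 < z.im, analyticOrderNatAt centredXi z ≤ N T := by
  rw [N, Finset.sum_congr rfl fun z hz ↦
    analyticOrderNatAt_centredXi (Finset.mem_filter.mp hz).2.ne',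
    ← Finset.sum_image (g := fun z : ℂ ↦ 1 / 2 + z) (fun _ _ _ _ h ↦ by simpa using h)]
  refine Finset.sum_le_sum_of_subset fun ρ hρ ↦ ?_
  obtain ⟨z, hz, rfl⟩ := Finset.mem_image.mp hρ
  obtain ⟨h1, h2⟩ := Finset.mem_filter.mp hz
  exact half_add_mem_zeros h1 h2

theorem sum_im_neg_eq (T : ℝ) :
    ∑ z ∈ discZeros T with z.im < 0, analyticOrderNatAt centredXi z =
      ∑ z ∈ discZeros T with 0 < z.im, analyticOrderNatAt centredXi z := by
  refine Finset.sum_nbij' (fun z ↦ -z) (fun z ↦ -z) ?_ ?_ ?_ ?_ ?_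
  · intro z
    simp [mem_discZeros, centredXi_neg]
  · intro z
    simp [mem_discZeros, centredXi_neg]
  · simp
  · simp
  · intro z _
    exact (analyticOrderNatAt_centredXi_neg z).symm

/-- The zeros in the upper and in the lower half plane are equally many, since `centredXi` is even;
those on the real axis, if any, all lie in the unit disc. -/
theorem discCount_le (T : ℝ) : discCount T ≤ 2 * N T + discCount 1 := by
  have hreal : ∑ z ∈ discZeros T with z.im = 0, analyticOrderNatAt centredXi z ≤ discCount 1 := by
    refine Finset.sum_le_sum_of_subset fun z hz ↦ ?_
    rw [Finset.mem_filter, mem_discZeros] at hz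
    refine mem_discZeros.mpr ⟨hz.1.1, ?_⟩
    have h1 := abs_re_le_of_centredXi_eq_zero hz.1.1
    have h2 := Complex.norm_le_abs_re_add_abs_im z
    rw [hz.2, abs_zero] at h2
    linarith
  have hpos := sum_im_pos_le T
  have hneg := sum_im_neg_eq T
  have hsplit : discCount T = ∑ z ∈ discZeros T with 0 < z.im, analyticOrderNatAt centredXi z +
      (∑ z ∈ discZeros T with z.im < 0, analyticOrderNatAt centredXi z +
        ∑ z ∈ discZeros T with z.im = 0, analyticOrderNatAt centredXi z) := by
    simp only [Finset.sum_filter, ← Finset.sum_add_distrib, discCount]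
    refine Finset.sum_congr rfl fun z _ ↦ ?_
    rcases lt_trichotomy z.im 0 with h | h | h
    · simp [h, h.ne, h.not_gt]
    · simp [h]
    · simp [h, h.ne', h.not_gt]
  omega

/-- Only finitely many circles about the origin meet the zeros in a given disc. -/
theorem exists_zeroFree_circle (T : ℝ) :
    ∃ R ∈ Set.Icc (T - 1) T, ∀ z ∈ Metric.sphere (0 : ℂ) R, centredXi z ≠ 0 := by
  obtain ⟨R, hR, hRn⟩ := (Set.Icc_infinite (sub_one_lt T)).exists_notMem_finset
    ((discZeros T).image fun z ↦ ‖z‖)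
  refine ⟨R, hR, fun z hz h0 ↦ hRn ?_⟩
  rw [mem_sphere_zero_iff_norm] at hz
  exact Finset.mem_image.mpr ⟨z, mem_discZeros.mpr ⟨h0, hz.le.trans hR.2⟩, hz⟩

/-! ### The lower bound for `N(T)` -/

open Real in
/-- The increase of the circle mean from radius `R / (1 + ε)` to a zero-free radius `R ∈ [T - 1, T]`
forces zeros: the main term of the mean increases by `ε / (1 + ε) * R log R / π`, while Jensen's
formula bounds the increase by `ε` times the number of zeros. -/
theorem exists_mul_log_le_N {ε : ℝ} (hε : 0 < ε) :
    ∃ C : ℝ, ∀ᶠ T : ℝ in atTop, T * Real.log T / (1 + ε) - C * T ≤ 2 * π * N T := by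
  obtain ⟨C, hC0, hC⟩ := exists_circleAverage_le
  obtain ⟨C', hC'0, hC'⟩ := exists_le_circleAverage
  have h1ε : 0 < 1 + ε := by linarith
  refine ⟨2 + π * ((C + C') / ε + discCount 1), ?_⟩
  filter_upwards [eventually_ge_atTop 10, eventually_ge_atTop (3 * (1 + ε) + 1)] with T hT hTε
  obtain ⟨R, ⟨hR1, hR2⟩, hRz⟩ := exists_zeroFree_circle T
  have hR : 9 ≤ R := by linarith
  set S := R / (1 + ε) with hS
  have hRS : R = S * (1 + ε) := by rw [hS]; field_simp
  have hS3 : 3 ≤ S := by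
    rw [hS, le_div_iff₀ h1ε]
    linarith
  have hSR : S ≤ R := by
    rw [hRS]
    nlinarith
  have hlogR : 0 ≤ Real.log R := Real.log_nonneg (by linarith)
  have hup := hC S hS3
  have hlow := hC' R hR hRz
  have hJ := circleAverage_sub_le (by linarith) hSR
  have hlogSR : Real.log R - Real.log S ≤ ε := by
    rw [hRS, Real.log_mul (by linarith) h1ε.ne']
    linarith [Real.log_le_sub_one_of_pos h1ε]
  have hcount : (discCount R : ℝ) ≤ 2 * N T + discCount 1 := by
    have h1 : discCount R ≤ discCount T := by
      refine Finset.sum_le_sum_of_subset fun z hz ↦ ?_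
      rw [mem_discZeros] at hz ⊢
      exact ⟨hz.1, hz.2.trans hR2⟩
    exact_mod_cast h1.trans (discCount_le T)
  have h1 : discCount R * (Real.log R - Real.log S) ≤ (2 * N T + discCount 1) * ε := by
    gcongr
    exact sub_nonneg.mpr (Real.log_le_log (by linarith) hSR)
  have h2 : S * Real.log S / π ≤ S * Real.log R / π := by
    have := Real.log_le_log (by linarith) hSR
    gcongr
  have h3 : R * Real.log R / π - S * Real.log R / π = ε * (R * Real.log R / (1 + ε)) / π := by
    rw [hS]
    field_simp
    ring
  have h4 : ε * (R * Real.log R / (1 + ε)) / π ≤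
      (2 * N T + discCount 1) * ε + (C + C') * T := by
    have : C * S ≤ C * T := by gcongr; linarith
    have : C' * R ≤ C' * T := by gcongr
    linarith
  have h5 : R * Real.log R / (1 + ε) ≤
      2 * π * N T + π * ((C + C') / ε + discCount 1) * T := by
    rw [div_le_iff₀ pi_pos] at h4
    have h6 : ε * (R * Real.log R / (1 + ε)) ≤
        ε * (π * (2 * N T + discCount 1 + (C + C') / ε * T)) := by
      refine h4.trans_eq ?_
      field_simp
    have h7 := le_of_mul_le_mul_left h6 hε
    have h8 : π * (discCount 1 : ℝ) ≤ π * (discCount 1 : ℝ) * T :=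
      le_mul_of_one_le_right (by positivity) (by linarith)
    linarith
  -- `(T - 1) log (T - 1) ≥ T log T - 2 T`
  have h6 : T * Real.log T - 2 * T ≤ R * Real.log R := by
    have hT1 : 0 < T - 1 := by linarith
    have h7 : Real.log T - Real.log (T - 1) ≤ 1 / (T - 1) := by
      rw [← Real.log_div (by linarith) hT1.ne']
      refine (Real.log_le_sub_one_of_pos (by positivity)).trans_eq ?_
      field_simp
      ring
    have h8 : (T - 1) * (Real.log T - Real.log (T - 1)) ≤ 1 := by
      calc _ ≤ (T - 1) * (1 / (T - 1)) := by gcongr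
        _ = 1 := by field_simp
    have h9 : (T - 1) * Real.log (T - 1) ≤ R * Real.log R := by
      have : 0 ≤ Real.log (T - 1) := Real.log_nonneg (by linarith)
      gcongr
    have h10 := Real.log_le_sub_one_of_pos (show 0 < T by linarith)
    nlinarith
  have h7 : T * Real.log T / (1 + ε) - 2 * T ≤ R * Real.log R / (1 + ε) := by
    rw [le_div_iff₀ h1ε, sub_mul, div_mul_cancel₀ _ h1ε.ne']
    nlinarith
  linarith

open Real in
/-- The lower half of the Riemann–von Mangoldt formula, to leading order. -/
theorem eventually_mul_log_le_N {δ : ℝ} (hδ : 0 < δ) :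
    ∀ᶠ T : ℝ in atTop, T / (2 * π) * Real.log T ≤ (1 + δ) * N T := by
  obtain ⟨C, hC⟩ := exists_mul_log_le_N (half_pos hδ)
  have hgap : 0 < 1 / (1 + δ / 2) - 1 / (1 + δ) := by
    rw [sub_pos]
    gcongr
    linarith
  filter_upwards [hC, eventually_gt_atTop 0,
    Real.tendsto_log_atTop.eventually_ge_atTop (C / (1 / (1 + δ / 2) - 1 / (1 + δ)))]
    with T h1 hT h2
  rw [div_le_iff₀ hgap] at h2
  have h3 : T * Real.log T / (1 + δ) ≤ 2 * π * N T := by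
    have h4 : C * T ≤ Real.log T * (1 / (1 + δ / 2) - 1 / (1 + δ)) * T := by gcongr
    have h5 : Real.log T * (1 / (1 + δ / 2) - 1 / (1 + δ)) * T =
      T * Real.log T / (1 + δ / 2) - T * Real.log T / (1 + δ) := by ring
    linarith
  rw [div_le_iff₀ (by linarith)] at h3
  have h6 : T / (2 * π) * Real.log T = T * Real.log T / (2 * π) := by ring
  rw [h6, div_le_iff₀ (by positivity)]
  linarith

/-! ### Simple zeros and zeros on the critical line -/

theorem mult_pos {T : ℝ} {ρ : ℂ} (hρ : ρ ∈ zeros T) : 0 < mult ρ := by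
  obtain ⟨h0, him, -⟩ := mem_zeros.mp hρ
  have h1 : centredXi (ρ - 1 / 2) = 0 := by
    have him' : (ρ - 1 / 2).im ≠ 0 := by simpa using him.ne'
    rw [centredXi_eq (half_add_ne_zero him') (half_sub_ne_zero him')
      (Gammaℝ_ne_zero_of_im_ne_zero (by simpa using him.ne')), add_sub_cancel, h0, mul_zero]
  have h2 := analyticOrderNatAt_centredXi_ne_zero_iff.mpr h1
  rw [analyticOrderNatAt_centredXi (by simpa using him.ne'), add_sub_cancel] at h2
  exact Nat.pos_of_ne_zero h2

/-- The functional equation and the reality of `ζ` make the zeros symmetric about the critical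
line. -/
theorem one_sub_conj_mem_zeros {T : ℝ} {ρ : ℂ} (hρ : ρ ∈ zeros T) :
    1 - starRingEnd ℂ ρ ∈ zeros T := by
  obtain ⟨h0, him, hT⟩ := mem_zeros.mp hρ
  refine mem_zeros.mpr ⟨?_, by simpa using him, by simpa using hT⟩
  have him' : (starRingEnd ℂ ρ).im ≠ 0 := by simpa using him.ne'
  rw [riemannZeta_one_sub, riemannZeta_conj, h0, map_zero, mul_zero]
  · intro n h
    rw [h] at him'
    simp at him'
  · intro h
    rw [h] at him'
    simp at him'

theorem one_sub_conj_ne {ρ : ℂ} (h : ¬OnLine ρ) : 1 - starRingEnd ℂ ρ ≠ ρ := by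
  intro he
  have := congrArg Complex.re he
  simp only [Complex.sub_re, Complex.one_re, Complex.conj_re] at this
  exact h (by unfold OnLine; linarith)

/-- Among the zeros on the horizontal line through `ρ` is `ρ` itself. -/
theorem mult_sq_le {T : ℝ} {ρ : ℂ} (hρ : ρ ∈ zeros T) :
    mult ρ * mult ρ ≤ ∑ ρ' ∈ zeros T with ρ.im = ρ'.im, mult ρ * mult ρ' :=
  Finset.single_le_sum (f := fun ρ' ↦ mult ρ * mult ρ') (fun _ _ ↦ Nat.zero_le _)
    (Finset.mem_filter.mpr ⟨hρ, rfl⟩)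

/-- An off-line zero `ρ` shares its horizontal line with the zero `1 - conj ρ`. -/
theorem two_mul_mult_le_of_not_onLine {T : ℝ} {ρ : ℂ} (hρ : ρ ∈ zeros T) (h : ¬OnLine ρ) :
    2 * mult ρ ≤ ∑ ρ' ∈ zeros T with ρ.im = ρ'.im, mult ρ * mult ρ' := by
  have hmem := one_sub_conj_mem_zeros hρ
  have hsub : {1 - starRingEnd ℂ ρ, ρ} ⊆ {ρ' ∈ zeros T | ρ.im = ρ'.im} := by
    intro x hx
    rcases Finset.mem_insert.mp hx with rfl | hx
    · exact Finset.mem_filter.mpr ⟨hmem, by simp⟩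
    · rw [Finset.mem_singleton.mp hx]
      exact Finset.mem_filter.mpr ⟨hρ, rfl⟩
  refine le_trans ?_ (Finset.sum_le_sum_of_subset hsub)
  rw [Finset.sum_pair (one_sub_conj_ne h)]
  have h1 := mult_pos hρ
  have h2 := mult_pos hmem
  nlinarith

open Classical in
theorem count_eq_sum_ite (P : ℂ → Prop) (T : ℝ) :
    count P T = ∑ ρ ∈ zeros T, if P ρ then mult ρ else 0 := by
  rw [count, Finset.sum_filter]

theorem two_mul_N_le_count_isSimple_add_pairs (T : ℝ) :
    2 * N T ≤ count IsSimple T + pairs T := by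
  classical
  rw [count_eq_sum_ite, pairs, N, Finset.mul_sum, ← Finset.sum_add_distrib]
  refine Finset.sum_le_sum fun ρ hρ ↦ le_trans ?_ (Nat.add_le_add_left (mult_sq_le hρ) _)
  have h1 := mult_pos hρ
  split_ifs with h
  · nlinarith
  · have : 2 ≤ mult ρ := by
      have : mult ρ ≠ 1 := h
      omega
    nlinarith

theorem two_mul_N_le_count_onLine_add_pairs (T : ℝ) :
    2 * N T ≤ count OnLine T + pairs T := by
  classical
  rw [count_eq_sum_ite, pairs, N, Finset.mul_sum, ← Finset.sum_add_distrib]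
  refine Finset.sum_le_sum fun ρ hρ ↦ ?_
  split_ifs with h
  · have h1 := mult_pos hρ
    have h2 := mult_sq_le hρ
    nlinarith
  · rw [zero_add]
    exact two_mul_mult_le_of_not_onLine hρ h

theorem count_add_count_le (P Q : ℂ → Prop) (T : ℝ) :
    count P T + count Q T ≤ count (fun ρ ↦ P ρ ∧ Q ρ) T + N T := by
  classical
  rw [count_eq_sum_ite, count_eq_sum_ite, count_eq_sum_ite, N, ← Finset.sum_add_distrib,
    ← Finset.sum_add_distrib]
  refine Finset.sum_le_sum fun ρ _ ↦ ?_
  by_cases hP : P ρ <;> by_cases hQ : Q ρ <;> simp [hP, hQ]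

/-- An asymptotic lower bound with an arbitrarily small loss, put in `o(1)` form. -/
theorem exists_tendsto_zero_of_forall_pos {l : Filter ℝ} {a : ℝ} {f g : ℝ → ℝ} (hf : ∀ T, 0 ≤ f T)
    (hg : ∀ T, 0 ≤ g T) (h : ∀ δ > 0, ∀ᶠ T in l, (a - δ) * f T ≤ g T) :
    ∃ e : ℝ → ℝ, Tendsto e l (𝓝 0) ∧ ∀ᶠ T in l, (a + e T) * f T ≤ g T := by
  refine ⟨fun T ↦ if f T = 0 then 0 else min 0 (g T / f T - a), ?_, .of_forall fun T ↦ ?_⟩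
  · rw [Metric.tendsto_nhds]
    intro δ hδ
    filter_upwards [h (δ / 2) (half_pos hδ)] with T hT
    rw [Real.dist_eq, sub_zero]
    split_ifs with h0
    · simpa using hδ
    · have hpos : 0 < f T := lt_of_le_of_ne (hf T) (Ne.symm h0)
      rw [← le_div_iff₀ hpos] at hT
      rw [abs_of_nonpos (min_le_left _ _), neg_lt]
      exact lt_min (by linarith) (by linarith)
  · dsimp only
    split_ifs with h0
    · rw [h0, mul_zero]
      exact hg T
    · have hpos : 0 < f T := lt_of_le_of_ne (hf T) (Ne.symm h0)
      rw [← le_div_iff₀ hpos]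
      linarith [min_le_right 0 (g T / f T - a)]

open Real in
/-- The bound for the pairs, restated with `N(T)` in place of `(T / 2π) log T`. -/
theorem eventually_pairs_le {C : ℝ} (hC1 : 1 ≤ C)
    (hpairs : ∃ e : ℝ → ℝ, Tendsto e atTop (𝓝 0) ∧
      ∀ᶠ T : ℝ in atTop, (pairs T : ℝ) ≤ (C + e T) * (T / (2 * π) * Real.log T))
    {δ : ℝ} (hδ : 0 < δ) : ∀ᶠ T : ℝ in atTop, (pairs T : ℝ) ≤ (C + δ) * N T := by
  obtain ⟨e, he, hp⟩ := hpairs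
  have hC : 0 < C + δ / 2 := by linarith
  have hη : 0 < δ / 2 / (C + δ / 2) := by positivity
  filter_upwards [hp, he.eventually_lt_const (half_pos hδ), eventually_mul_log_le_N hη,
    eventually_ge_atTop 1] with T h1 h2 h3 hT
  have hlog := Real.log_nonneg hT
  have h4 : (C + e T) * (T / (2 * π) * Real.log T) ≤
      (C + δ / 2) * (T / (2 * π) * Real.log T) := by
    gcongr
  have h5 : (C + δ / 2) * ((1 + δ / 2 / (C + δ / 2)) * N T) = (C + δ) * N T := by
    field_simp
    ring
  calc (pairs T : ℝ) ≤ (C + δ / 2) * (T / (2 * π) * Real.log T) := h1.trans h4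
    _ ≤ (C + δ / 2) * ((1 + δ / 2 / (C + δ / 2)) * N T) := by gcongr
    _ = _ := h5

end ZetaZeros

theorem theorem2 (C : ℝ) (hC1 : 1 ≤ C) (hC2 : C < 2)
    (hpairs : ∃ e : ℝ → ℝ, Tendsto e atTop (𝓝 0) ∧
      ∀ᶠ T : ℝ in atTop,
        (ZetaZeros.pairs T : ℝ) ≤ (C + e T) * (T / (2 * Real.pi) * Real.log T)) :
    (∃ e : ℝ → ℝ, Tendsto e atTop (𝓝 0) ∧
      ∀ᶠ T : ℝ in atTop,
        (2 - C + e T) * (ZetaZeros.N T : ℝ) ≤ (ZetaZeros.count ZetaZeros.IsSimple T : ℝ)) ∧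
    (∃ e : ℝ → ℝ, Tendsto e atTop (𝓝 0) ∧
      ∀ᶠ T : ℝ in atTop,
        (2 - C + e T) * (ZetaZeros.N T : ℝ) ≤ (ZetaZeros.count ZetaZeros.OnLine T : ℝ)) ∧
    (C < 3 / 2 → ∃ e : ℝ → ℝ, Tendsto e atTop (𝓝 0) ∧
      ∀ᶠ T : ℝ in atTop,
        (3 - 2 * C + e T) * (ZetaZeros.N T : ℝ) ≤
          (ZetaZeros.count (fun ρ => ZetaZeros.OnLine ρ ∧ ZetaZeros.IsSimple ρ) T : ℝ)) := by
  have hs : ∀ T, (2 * ZetaZeros.N T : ℝ) ≤ ZetaZeros.count ZetaZeros.IsSimple T +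
      ZetaZeros.pairs T := fun T ↦ by
    exact_mod_cast ZetaZeros.two_mul_N_le_count_isSimple_add_pairs T
  have hl : ∀ T, (2 * ZetaZeros.N T : ℝ) ≤ ZetaZeros.count ZetaZeros.OnLine T +
      ZetaZeros.pairs T := fun T ↦ by
    exact_mod_cast ZetaZeros.two_mul_N_le_count_onLine_add_pairs T
  have hls : ∀ T, (ZetaZeros.count ZetaZeros.OnLine T + ZetaZeros.count ZetaZeros.IsSimple T : ℝ) ≤
      ZetaZeros.count (fun ρ ↦ ZetaZeros.OnLine ρ ∧ ZetaZeros.IsSimple ρ) T +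
        ZetaZeros.N T := fun T ↦ by
    exact_mod_cast ZetaZeros.count_add_count_le ZetaZeros.OnLine ZetaZeros.IsSimple T
  refine ⟨?_, ?_, fun _ ↦ ?_⟩ <;>
    refine ZetaZeros.exists_tendsto_zero_of_forall_pos (fun _ ↦ Nat.cast_nonneg _)
      (fun _ ↦ Nat.cast_nonneg _) fun δ hδ ↦ ?_
  · filter_upwards [ZetaZeros.eventually_pairs_le hC1 hpairs hδ] with T hT
    linarith [hs T]
  · filter_upwards [ZetaZeros.eventually_pairs_le hC1 hpairs hδ] with T hT
    linarith [hl T]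
  · filter_upwards [ZetaZeros.eventually_pairs_le hC1 hpairs (half_pos hδ)] with T hT
    linarith [hs T, hl T, hls T]
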